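/- A *stick representation* of a bipartite graph $G=(A\cup B,E)$ with sets $A$ and $B$ represents each vertex of $A$ by a vertical segment and each vertex of $B$ by a horizontal segment in the plane, such that the bottom end-points of the vertical segments and the left end-points of the horizontal segments all lie on one line of slope $-1$, and two distinct vertices are adjacent if and only if their segments intersect. A *(rotated) L-shape* consists of a vertical segment, whose bottom end-point is called the *anchor*, and a horizontal segment whose right end-point is the top end-point of the vertical segment. A graph is a *grounded L-graph* if it is the intersection graph of a family of L-shapes whose anchors all lie on one horizontal line. All segments have positive length. Let $\Lambda$ be the graph with vertices $1,\dots,10$ and the following edges: those of the three triangles $\{1,2,3\}$, $\{4,5,6\}$, $\{7,8,9\}$; the edges $\{i,i+3\}$ and $\{i,i+6\}$ for $i=1,2,3$; and the edges joining $10$ to $4$, $6$, $7$ and $9$. For a vertex $x$, let $\Lambda(x)$ be a copy of $\Lambda$ in which $x$ is the vertex with label $2$. Given a finite simple bipartite graph $G=(A\cup B,E)$ with given parts $A$ and $B$, let $H$ be the graph formed by the vertices of $A$ (pairwise non-adjacent) and by pairwise disjoint copies $\Lambda(b)$, $b\in B$ (with no edges between different copies), together with, for each edge $ab\in E$ with $a\in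 A$, $b\in B$, all edges from $a$ to the vertices of $\Lambda(b)$. **Proposition.** $G$ has a stick representation with sets $A$ and $B$ if and only if $H$ is a grounded L-graph. -/

import Mathlib

/-- The vertical segment of length `h` whose bottom end-point is `p`. -/
def vSegment (p : ℝ × ℝ) (h : ℝ) : Set (ℝ × ℝ) :=
  {p.1} ×ˢ Set.Icc p.2 (p.2 + h)

/-- The horizontal segment of length `w` whose left end-point is `p`. -/
def hSegment (p : ℝ × ℝ) (w : ℝ) : Set (ℝ × ℝ) :=
  Set.Icc p.1 (p.1 + w) ×ˢ {p.2}

/-- The family `S` of subsets of the plane is an intersection representation of `G`. -/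
def IsIntersectionRep {V : Type*} (G : SimpleGraph V) (S : V → Set (ℝ × ℝ)) : Prop :=
  ∀ u v : V, u ≠ v → (G.Adj u v ↔ (S u ∩ S v).Nonempty)

/-- An L-shape turned by 180 degrees: a vertical segment going up from its bottom end-point
(the anchor), and a horizontal segment going left from the top of the vertical one. -/
structure LShape where
  anchor : ℝ × ℝ
  height : ℝ
  width : ℝ
  height_pos : 0 < height
  width_pos : 0 < width

namespace LShape

/-- The vertical segment of an L-shape. -/
def vertical (L : LShape) : Set (ℝ × ℝ) := vSegment L.anchor L.height

/-- The horizontal segment of an L-shape; its right end-point is the top of the vertical one. -/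
def horizontal (L : LShape) : Set (ℝ × ℝ) :=
  hSegment (L.anchor.1 - L.width, L.anchor.2 + L.height) L.width

/-- The set of points of an L-shape. -/
def carrier (L : LShape) : Set (ℝ × ℝ) := L.vertical ∪ L.horizontal

end LShape

/-- `G` is a grounded L-graph: the intersection graph of L-shapes whose anchors all lie on one
horizontal line `y = g`. -/
def IsGroundedLGraph {V : Type*} (G : SimpleGraph V) : Prop :=
  ∃ (g : ℝ) (L : V → LShape),
    (∀ v, (L v).anchor.2 = g) ∧ IsIntersectionRep G (fun v => (L v).carrier)

/-- `G` has a stick representation with sets `A` and `B`: the vertices in `A` are represented by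
vertical segments and those in `B` by horizontal segments, the bottom end-points of the former and
the left end-points of the latter lying on one line `y = c - x` of slope `-1`. -/
def IsStickGraph {V : Type*} (G : SimpleGraph V) (A B : Set V) : Prop :=
  ∃ (c : ℝ) (p : V → ℝ × ℝ) (len : V → ℝ) (S : V → Set (ℝ × ℝ)),
    (∀ v, (p v).2 = c - (p v).1) ∧ (∀ v, 0 < len v) ∧
    (∀ a ∈ A, S a = vSegment (p a) (len a)) ∧
    (∀ b ∈ B, S b = hSegment (p b) (len b)) ∧
    IsIntersectionRep G S

/-- The edges of the gadget, its vertices being labelled `1, …, 10`: three triangles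
`123`, `456`, `789`; the edges joining `i` to `i + 3` and to `i + 6` for `i = 1, 2, 3`; and the
edges joining `10` to the neighbours of `1` and of `3` in the other two triangles. -/
def gadgetEdges : Finset (Sym2 ℕ) :=
  {s(1, 2), s(1, 3), s(2, 3),
   s(4, 5), s(4, 6), s(5, 6),
   s(7, 8), s(7, 9), s(8, 9),
   s(1, 4), s(2, 5), s(3, 6),
   s(1, 7), s(2, 8), s(3, 9),
   s(10, 4), s(10, 7), s(10, 6), s(10, 9)}

/-- The gadget graph `Λ`; the element `k` of `Fin 10` is the vertex with label `k + 1`.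
In `Λ(x)`, the vertex with label `2` is `x`. -/
def gadget : SimpleGraph (Fin 10) where
  Adj i j := s((i : ℕ) + 1, (j : ℕ) + 1) ∈ gadgetEdges
  symm := ⟨by decide⟩
  loopless := ⟨by decide⟩

/-- Adjacency in the graph `H` built from `G` with parts `A` and `B`. The vertex `Sum.inl a` is
`a ∈ A`, and `Sum.inr (b, k)` is the vertex `k` of the copy `Λ(b)` of the gadget. -/
def reductionAdj {V : Type*} (G : SimpleGraph V) (A B : Set V) :
    A ⊕ (B × Fin 10) → A ⊕ (B × Fin 10) → Prop
  | Sum.inl _, Sum.inl _ => False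
  | Sum.inl a, Sum.inr (b, _) => G.Adj a b
  | Sum.inr (b, _), Sum.inl a => G.Adj a b
  | Sum.inr (b, i), Sum.inr (b', j) => b = b' ∧ gadget.Adj i j

/-- The graph `H`: the vertices of `A`, pairwise disjoint copies `Λ(b)` of the gadget for `b ∈ B`,
and, for each edge `ab` of `G`, all edges from `a` to `Λ(b)`. -/
def reductionGraph {V : Type*} (G : SimpleGraph V) (A B : Set V) :
    SimpleGraph (A ⊕ (B × Fin 10)) where
  Adj := reductionAdj G A B
  symm := ⟨by
    rintro (a | ⟨b, i⟩) (a' | ⟨b', j⟩) h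
    · exact h
    · exact h
    · exact h
    · exact ⟨h.1.symm, SimpleGraph.Adj.symm h.2⟩⟩
  loopless := ⟨by
    rintro (a | ⟨b, i⟩) h
    · exact h
    · exact gadget.irrefl h.2⟩

/-! A grounded L-representation in which every neighbour a ∈ A of b ∈ B is anchored at or to the
right of b is essentially a stick representation. If b is left of a, the L-shapes meet iff the
height of a is at most that of b and the horizontal part of a reaches back to b. With x for
abscissae and l for lengths, sticks meet iff x(b) ≤ x(a) ≤ x(b) + l(b) and x(a) - l(a) ≤ x(b), so
heights play the role of right end-points.

The gadget enforces the order. Let S meet all of Λ. Among shapes right of S the left ends reach past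
S, so adjacency depends on heights alone and the induced graph is a permutation graph. Among shapes
left of S, neighbourhoods to the right of S grow from left to right. If label 2 were right of S,
these constraints would leave either a single vertex z or all other vertices on the left
(`gadget_cut`). The former is impossible since Λ - z is no permutation graph; the latter contradicts
a crossing condition (`gadget_order`). Conversely, Λ has a representation that can be shrunk and
inserted in place of each b. -/

namespace LShape

/-- The left end-point of the horizontal segment. -/
def left (L : LShape) : ℝ := L.anchor.1 - L.width

lemma left_lt (L : LShape) : L.left < L.anchor.1 := by
  have := L.width_pos
  unfold left; linarith

lemma mem_carrier {L : LShape} {p : ℝ × ℝ} : p ∈ L.carrier ↔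
    (p.1 = L.anchor.1 ∧ L.anchor.2 ≤ p.2 ∧ p.2 ≤ L.anchor.2 + L.height) ∨
    (L.left ≤ p.1 ∧ p.1 ≤ L.anchor.1 ∧ p.2 = L.anchor.2 + L.height) := by
  simp [carrier, vertical, horizontal, vSegment, hSegment, left, Set.mem_prod, and_assoc]

/-- Grounded L-shapes are ordered by their anchors from left to right, and those with a common
anchor by decreasing height. -/
def key (L : LShape) : ℝ ×ₗ ℝᵒᵈ := toLex (L.anchor.1, OrderDual.toDual L.height)

lemma key_le_key {L M : LShape} : L.key ≤ M.key ↔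
    L.anchor.1 < M.anchor.1 ∨ L.anchor.1 = M.anchor.1 ∧ M.height ≤ L.height := by
  simp [key, Prod.Lex.toLex_le_toLex]

lemma anchor_le_of_key_le {L M : LShape} (h : L.key ≤ M.key) : L.anchor.1 ≤ M.anchor.1 := by
  rcases key_le_key.1 h with h | h
  exacts [h.le, h.1.le]

/-- Two grounded L-shapes intersect iff the horizontal segment of the right one crosses the
vertical segment of the left one. -/
lemma inter_nonempty_iff {L M : LShape} (hg : L.anchor.2 = M.anchor.2) (hk : L.key ≤ M.key) :
    (L.carrier ∩ M.carrier).Nonempty ↔ M.height ≤ L.height ∧ M.left ≤ L.anchor.1 := by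
  have hk' := key_le_key.1 hk
  have hL := L.left_lt
  have hM := M.left_lt
  constructor
  · rintro ⟨p, hp, hq⟩
    rw [mem_carrier] at hp hq
    rcases hk' with hk' | ⟨hk', hh⟩
    · rcases hp with ⟨h1, h2, h3⟩ | ⟨h1, h2, h3⟩ <;> rcases hq with ⟨h4, h5, h6⟩ | ⟨h4, h5, h6⟩ <;>
        constructor <;> linarith
    · exact ⟨hh, by linarith⟩
  · rintro ⟨h1, h2⟩
    have := M.height_pos
    refine ⟨(L.anchor.1, M.anchor.2 + M.height), mem_carrier.2 (Or.inl ?_), mem_carrier.2 (Or.inr ?_)⟩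
    · exact ⟨rfl, by simp only; linarith, by simp only; linarith⟩
    · exact ⟨h2, anchor_le_of_key_le hk, rfl⟩

lemma inter_nonempty_iff_of_lt {L M : LShape} (hg : L.anchor.2 = M.anchor.2)
    (hk : L.anchor.1 < M.anchor.1) :
    (L.carrier ∩ M.carrier).Nonempty ↔ M.height ≤ L.height ∧ M.left ≤ L.anchor.1 :=
  inter_nonempty_iff hg (key_le_key.2 (Or.inl hk))

end LShape

instance : DecidableRel gadget.Adj := fun i j =>
  inferInstanceAs (Decidable (s((i : ℕ) + 1, (j : ℕ) + 1) ∈ gadgetEdges))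

/-! ### Permutation-graph obstructions and the order forced by the gadget -/

/-- The six-cycle is no permutation graph: its vertices cannot be ordered such that both adjacency
and non-adjacency of distinct vertices are transitive along the order. -/
lemma not_permutation_hexagon {κ : Type*} [LinearOrder κ] (f : Fin 6 → κ)
    (h1 : ∀ i j k, i ≠ j → j ≠ k → i ≠ k → f i ≤ f j → f j ≤ f k →
      (SimpleGraph.cycleGraph 6).Adj i j → (SimpleGraph.cycleGraph 6).Adj j k →
      (SimpleGraph.cycleGraph 6).Adj i k)
    (h2 : ∀ i j k, i ≠ j → j ≠ k → i ≠ k → f i ≤ f j → f j ≤ f k →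
      ¬ (SimpleGraph.cycleGraph 6).Adj i j → ¬ (SimpleGraph.cycleGraph 6).Adj j k →
      ¬ (SimpleGraph.cycleGraph 6).Adj i k) : False := by
  obtain ⟨i, hi⟩ := Finite.exists_min f
  have hd : ∀ i : Fin 6, i ≠ i + 1 ∧ i + 1 ≠ i + 2 ∧ i ≠ i + 2 ∧ i ≠ i + 5 ∧ i + 5 ≠ i + 4 ∧
      i ≠ i + 4 ∧ i + 2 ≠ i + 5 ∧ i + 4 ≠ i + 1 := by decide
  have hc : ∀ i : Fin 6, (SimpleGraph.cycleGraph 6).Adj i (i + 1) ∧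
      (SimpleGraph.cycleGraph 6).Adj (i + 1) (i + 2) ∧
      ¬ (SimpleGraph.cycleGraph 6).Adj i (i + 2) ∧
      (SimpleGraph.cycleGraph 6).Adj i (i + 5) ∧
      (SimpleGraph.cycleGraph 6).Adj (i + 5) (i + 4) ∧
      ¬ (SimpleGraph.cycleGraph 6).Adj i (i + 4) ∧
      ¬ (SimpleGraph.cycleGraph 6).Adj (i + 2) (i + 5) ∧
      ¬ (SimpleGraph.cycleGraph 6).Adj (i + 4) (i + 1) := by decide
  obtain ⟨d1, d2, d3, d4, d5, d6, d7, d8⟩ := hd i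
  obtain ⟨c1, c2, c3, c4, c5, c6, c7, c8⟩ := hc i
  -- Starting at a minimum i, these four inequalities form a cycle.
  have e1 : f (i + 2) < f (i + 1) := not_le.1 fun h => c3 (h1 _ _ _ d1 d2 d3 (hi _) h c1 c2)
  have e2 : f (i + 4) < f (i + 5) := not_le.1 fun h => c6 (h1 _ _ _ d4 d5 d6 (hi _) h c4 c5)
  have e3 : f (i + 5) < f (i + 2) := not_le.1 fun h => h2 _ _ _ d3 d7 d4 (hi _) h c3 c7 c4
  have e4 : f (i + 1) < f (i + 4) := not_le.1 fun h => h2 _ _ _ d6 d8 d1 (hi _) h c6 c8 c1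
  exact lt_irrefl _ (e1.trans (e4.trans (e2.trans e3)))

/-- Deleting a vertex other than that with label 2 from the gadget does not leave a permutation
graph. -/
lemma not_permutation_gadget_delete {κ : Type*} [LinearOrder κ] (f : Fin 10 → κ) (s : κ)
    (h1 : ∀ i j k, i ≠ j → j ≠ k → i ≠ k → s ≤ f i → f i ≤ f j → f j ≤ f k →
      gadget.Adj i j → gadget.Adj j k → gadget.Adj i k)
    (h2 : ∀ i j k, i ≠ j → j ≠ k → i ≠ k → s ≤ f i → f i ≤ f j → f j ≤ f k →
      ¬ gadget.Adj i j → ¬ gadget.Adj j k → ¬ gadget.Adj i k)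
    (z : Fin 10) (hz : z ≠ 1) : ¬ ∀ u, u ≠ z → s ≤ f u := by
  intro hs
  have cyc : ∀ v : Fin 6 → Fin 10, (∀ i, v i ≠ z) → (∀ i j, i ≠ j → v i ≠ v j) →
      (∀ i j, gadget.Adj (v i) (v j) ↔ (SimpleGraph.cycleGraph 6).Adj i j) → False := by
    intro v hvz hv hadj
    refine not_permutation_hexagon (f ∘ v) (fun i j k a b c ij jk => ?_)
      (fun i j k a b c ij jk => ?_)
    · simpa only [hadj] using h1 _ _ _ (hv _ _ a) (hv _ _ b) (hv _ _ c) (hs _ (hvz i)) ij jk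
    · simpa only [hadj] using h2 _ _ _ (hv _ _ a) (hv _ _ b) (hv _ _ c) (hs _ (hvz i)) ij jk
  have compl : ∀ v : Fin 6 → Fin 10, (∀ i, v i ≠ z) → (∀ i j, i ≠ j → v i ≠ v j) →
      (∀ i j, i ≠ j → (¬ gadget.Adj (v i) (v j) ↔ (SimpleGraph.cycleGraph 6).Adj i j)) →
      False := by
    intro v hvz hv hadj
    refine not_permutation_hexagon (f ∘ v) (fun i j k a b c ij jk => ?_)
      (fun i j k a b c ij jk => ?_)
    · rw [← hadj i j a, ← hadj j k b, ← hadj i k c]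
      exact h2 _ _ _ (hv _ _ a) (hv _ _ b) (hv _ _ c) (hs _ (hvz i)) ij jk
    · rw [← hadj i j a, ← hadj j k b, ← hadj i k c, not_not, not_not, not_not]
      exact h1 _ _ _ (hv _ _ a) (hv _ _ b) (hv _ _ c) (hs _ (hvz i)) ij jk
  -- Without label 1 or 3, an induced six-cycle through 10 survives. Any other z misses one of the
  -- two prisms on 1–6 and on 1, 2, 3, 7, 8, 9, whose complements are six-cycles.
  have hcases : z = 0 ∨ z = 2 ∨ (z ≠ 0 ∧ z ≠ 1 ∧ z ≠ 2 ∧ z ≠ 3 ∧ z ≠ 4 ∧ z ≠ 5) ∨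
      (z ≠ 0 ∧ z ≠ 1 ∧ z ≠ 2 ∧ z ≠ 6 ∧ z ≠ 7 ∧ z ≠ 8) := by
    clear hs cyc compl; revert z; decide
  rcases hcases with rfl | rfl | h | h
  · exact cyc ![1, 4, 3, 9, 6, 7] (by decide) (by decide) (by decide)
  · exact cyc ![1, 4, 5, 9, 8, 7] (by decide) (by decide) (by decide)
  · refine compl ![0, 4, 2, 3, 1, 5] ?_ (by decide) (by decide)
    simp only [Fin.forall_fin_succ]; simp; grind
  · refine compl ![0, 7, 2, 6, 1, 8] ?_ (by decide) (by decide)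
    simp only [Fin.forall_fin_succ]; simp; grind

/-- The possible sets `P` of vertices of the gadget which contain `z` and not the vertex with label
2, under two conditions on the edges leaving `P`. -/
lemma gadget_cut (P : Fin 10 → Prop) (z : Fin 10) (hz : P z) (h1 : ¬ P 1)
    (hprop : ∀ u d, gadget.Adj u d → ¬ gadget.Adj z d → P u → P d)
    (hnest : ∀ d u v, gadget.Adj u d → ¬ gadget.Adj u 1 → gadget.Adj v 1 → ¬ gadget.Adj v d →
      P u → P v → P d) : (∀ u, u ≠ 1 → P u) ∨ ∀ u, u ≠ z → ¬ P u := by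
  -- Together with `hprop`, these six instances suffice for every z.
  have n0 := hnest 0 3 4 (by decide) (by decide) (by decide) (by decide)
  have n2 := hnest 2 5 4 (by decide) (by decide) (by decide) (by decide)
  have n3 := hnest 3 9 7 (by decide) (by decide) (by decide) (by decide)
  have n5 := hnest 5 9 7 (by decide) (by decide) (by decide) (by decide)
  have n6 := hnest 6 9 4 (by decide) (by decide) (by decide) (by decide)
  have n8 := hnest 8 9 4 (by decide) (by decide) (by decide) (by decide)
  clear hnest
  fin_cases z <;> simp +decide [Fin.forall_fin_succ] at hprop hz ⊢ <;> grind

/-- The combinatorial core of `anchor_le_of_forall_inter_gadget`: here `f` is the order of the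
anchors of the gadget, and `s` the position of an L-shape intersecting the whole gadget. -/
lemma gadget_order {κ : Type*} [LinearOrder κ] (f : Fin 10 → κ) (s : κ)
    (hcross : ∀ a b c d, a ≠ b → b ≠ c → c ≠ d → f a ≤ f b → f b ≤ f c → f c ≤ f d →
      gadget.Adj a c → gadget.Adj b d → ¬ gadget.Adj c d → gadget.Adj b c)
    (hleft : ∀ u v d, f u ≤ f v → f v < s → s ≤ f d → gadget.Adj u d → gadget.Adj v d)
    (h1 : ∀ i j k, i ≠ j → j ≠ k → i ≠ k → s ≤ f i → f i ≤ f j → f j ≤ f k →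
      gadget.Adj i j → gadget.Adj j k → gadget.Adj i k)
    (h2 : ∀ i j k, i ≠ j → j ≠ k → i ≠ k → s ≤ f i → f i ≤ f j → f j ≤ f k →
      ¬ gadget.Adj i j → ¬ gadget.Adj j k → ¬ gadget.Adj i k) : f 1 < s := by
  by_contra! hs
  have hdel := not_permutation_gadget_delete f s h1 h2
  have hex : ∃ z, f z < s := by
    by_contra! h
    exact hdel 0 (by decide) fun u _ => h u
  -- The last vertex z before s has the largest neighbourhood beyond s, so a non-neighbour of z
  -- beyond s has no neighbour before s.
  obtain ⟨⟨z, hz⟩, hmax⟩ := have : Nonempty {z // f z < s} := hex.elim fun z hz => ⟨z, hz⟩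
    Finite.exists_max fun z : {z // f z < s} => f z
  have hprop : ∀ u d, gadget.Adj u d → ¬ gadget.Adj z d → f u < s → f d < s :=
    fun u d hud hzd hu => not_le.1 fun hd => hzd (hleft u z d (hmax ⟨u, hu⟩) hz hd hud)
  have hnest : ∀ d u v, gadget.Adj u d → ¬ gadget.Adj u 1 → gadget.Adj v 1 → ¬ gadget.Adj v d →
      f u < s → f v < s → f d < s := by
    intro d u v ud u1 v1 vd hu hv
    by_contra! hd
    rcases le_total (f u) (f v) with h | h
    exacts [vd (hleft u v d h hv hd ud), u1 (hleft v u 1 h hu hs v1)]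
  have hz1 : z ≠ 1 := by rintro rfl; exact absurd hs (not_le.2 hz)
  have hall := (gadget_cut (fun u => f u < s) z hz (not_lt.2 hs) hprop hnest).resolve_right
    fun h => hdel z hz1 fun u hu => not_lt.1 (h u hu)
  have hnbr : ∀ u c, u ≠ 1 → c ≠ 1 → ¬ gadget.Adj u 1 → gadget.Adj c 1 → f u < f c :=
    fun u c hu _ nu hc => not_le.1 fun h => nu (hleft c u 1 h (hall u hu) hs hc)
  -- If a came before b, then a, b, c, d would be in this order, and `hcross` would make b adjacent
  -- to c.
  have hsep : ∀ c d b a, gadget.Adj c 1 ∧ gadget.Adj d 1 ∧ ¬ gadget.Adj c d ∧ c ≠ d ∧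
      ¬ gadget.Adj b 1 ∧ b ≠ 1 ∧ gadget.Adj b d ∧ ¬ gadget.Adj b c ∧ gadget.Adj a c ∧ a ≠ b → 
      f c ≤ f d → f b < f a := by
    rintro c d b a ⟨hc, hd, ncd, hne, nb, b1, hbd, hbc, hac, hab⟩ h
    have hc1 : c ≠ 1 := by rintro rfl; exact gadget.irrefl hc
    have hbc' : b ≠ c := by rintro rfl; exact nb hc
    exact not_le.1 fun h' => hbc (hcross a b c d hab hbc' hne h' (hnbr b c b1 hc1 nb hc).le h hac hbd ncd)
  -- Swapping the triangles 456 and 789 exchanges the two cases. In each, the later of labels 5 and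
  -- 8 also follows labels 1 and 3, and comparing it with these two gives opposite inequalities.
  rcases le_total (f 4) (f 7) with h | h
  · have a1 := hsep 4 7 6 3 (by decide) h
    have a2 := hsep 4 7 8 5 (by decide) h
    have c1 : f 0 ≤ f 7 := by
      by_contra! h'
      exact lt_asymm a1 (hsep 7 0 3 6 (by decide) h'.le)
    have c2 : f 2 ≤ f 7 := by
      by_contra! h'
      exact lt_asymm a2 (hsep 7 2 5 8 (by decide) h'.le)
    exact lt_asymm (hsep 0 7 8 6 (by decide) c1) (hsep 2 7 6 8 (by decide) c2)
  · have a1 := hsep 7 4 3 6 (by decide) h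
    have a2 := hsep 7 4 5 8 (by decide) h
    have c1 : f 0 ≤ f 4 := by
      by_contra! h'
      exact lt_asymm a1 (hsep 4 0 6 3 (by decide) h'.le)
    have c2 : f 2 ≤ f 4 := by
      by_contra! h'
      exact lt_asymm a2 (hsep 4 2 8 5 (by decide) h'.le)
    exact lt_asymm (hsep 0 4 5 3 (by decide) c1) (hsep 2 4 3 5 (by decide) c2)

/-- In a representation of the gadget by grounded L-shapes, every further L-shape that intersects
all of them has its anchor to the right of that of the vertex with label 2. -/
lemma anchor_le_of_forall_inter_gadget {g : ℝ} {L : Fin 10 → LShape} {S : LShape}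
    (hL : ∀ k, (L k).anchor.2 = g) (hS : S.anchor.2 = g)
    (hrep : IsIntersectionRep gadget fun k => (L k).carrier)
    (hSL : ∀ k, (S.carrier ∩ (L k).carrier).Nonempty) : (L 1).anchor.1 ≤ S.anchor.1 := by
  have hadj : ∀ u v, u ≠ v → (L u).key ≤ (L v).key →
      (gadget.Adj u v ↔ (L v).height ≤ (L u).height ∧ (L v).left ≤ (L u).anchor.1) :=
    fun u v huv h => (hrep u v huv).trans (LShape.inter_nonempty_iff ((hL u).trans (hL v).symm) h)
  have hl : ∀ u, (L u).key ≤ S.key → S.height ≤ (L u).height ∧ S.left ≤ (L u).anchor.1 :=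
    fun u h => (LShape.inter_nonempty_iff ((hL u).trans hS.symm) h).1 (Set.inter_comm _ _ ▸ hSL u)
  have hr : ∀ u, S.key ≤ (L u).key → (L u).height ≤ S.height ∧ (L u).left ≤ S.anchor.1 :=
    fun u h => (LShape.inter_nonempty_iff (hS.trans (hL u).symm) h).1 (hSL u)
  -- Right of S the condition on left ends is automatic, since they reach back to S.
  have hright : ∀ i j, i ≠ j → S.key ≤ (L i).key → (L i).key ≤ (L j).key →
      (gadget.Adj i j ↔ (L j).height ≤ (L i).height) := by
    intro i j hij hi h
    have := LShape.anchor_le_of_key_le hi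
    have := hr j (hi.trans h)
    rw [hadj i j hij h, and_iff_left]
    linarith
  refine LShape.anchor_le_of_key_le
    (gadget_order (fun k => (L k).key) S.key ?_ ?_ ?_ ?_).le
  · intro a b c d hab hbc hcd kab kbc kcd hac hbd ncd
    have x1 := LShape.anchor_le_of_key_le kab
    have x2 := LShape.anchor_le_of_key_le kbc
    have hne : a ≠ c := by rintro rfl; exact gadget.irrefl hac
    have hne' : b ≠ d := by rintro rfl; exact gadget.irrefl hbd
    rw [hadj a c hne (kab.trans kbc)] at hac
    rw [hadj b d hne' (kbc.trans kcd)] at hbd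
    rw [hadj c d hcd kcd] at ncd
    rw [hadj b c hbc kbc]
    refine ⟨?_, by linarith⟩
    by_contra! hlt
    exact ncd ⟨by linarith, by linarith⟩
  · intro u v d kuv kv kd hud
    have huv := LShape.anchor_le_of_key_le kuv
    have hne : u ≠ d := by rintro rfl; exact gadget.irrefl hud
    have hne' : v ≠ d := by rintro rfl; exact absurd kd (not_le.2 kv)
    rw [hadj u d hne (kuv.trans (kv.le.trans kd))] at hud
    rw [hadj v d hne' (kv.le.trans kd)]
    exact ⟨(hr d kd).1.trans (hl v kv.le).1, by linarith⟩
  · intro i j k hij hjk hik ki kij kjk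
    rw [hright i j hij ki kij, hright j k hjk (ki.trans kij) kjk, hright i k hik ki (kij.trans kjk)]
    intro a b; linarith
  · intro i j k hij hjk hik ki kij kjk
    rw [hright i j hij ki kij, hright j k hjk (ki.trans kij) kjk, hright i k hik ki (kij.trans kjk)]
    intro a b; linarith

/-! ### From grounded L-shapes to sticks -/

lemma vSegment_inter_hSegment_nonempty {c x y l w : ℝ} :
    (vSegment (x, c - x) l ∩ hSegment (y, c - y) w).Nonempty ↔
      y ≤ x ∧ x ≤ y + w ∧ x - l ≤ y := by
  constructor
  · rintro ⟨⟨q1, q2⟩, ⟨h1, h2, h3⟩, ⟨h4, h5⟩, h6⟩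
    simp only [Set.mem_singleton_iff] at h1 h2 h3 h4 h5 h6
    exact ⟨by linarith, by linarith, by linarith⟩
  · rintro ⟨h1, h2, h3⟩
    refine ⟨(x, c - y), ⟨rfl, ?_, ?_⟩, ⟨h1, h2⟩, rfl⟩ <;> simp only <;> linarith

lemma fst_eq_of_vSegment_inter_nonempty {p q : ℝ × ℝ} {l m : ℝ}
    (h : (vSegment p l ∩ vSegment q m).Nonempty) : p.1 = q.1 := by
  obtain ⟨r, ⟨h1, _⟩, h2, _⟩ := h
  exact h1.symm.trans h2

lemma snd_eq_of_hSegment_inter_nonempty {p q : ℝ × ℝ} {l m : ℝ}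
    (h : (hSegment p l ∩ hSegment q m).Nonempty) : p.2 = q.2 := by
  obtain ⟨r, ⟨_, h1⟩, _, h2⟩ := h
  exact h1.symm.trans h2

lemma LShape.anchor_mem_carrier (L : LShape) : L.anchor ∈ L.carrier :=
  mem_carrier.2 (Or.inl ⟨rfl, le_rfl, by linarith [L.height_pos]⟩)

section
variable {V : Type*} {G : SimpleGraph V} {A B : Set V}

lemma not_adj_of_isBipartiteWith (hG : G.IsBipartiteWith A B) :
    ∀ u ∈ A, ∀ v ∈ A, ¬ G.Adj u v := by
  intro u hu v hv huv
  rcases hG.mem_of_adj huv with h | h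
  exacts [Set.disjoint_left.1 hG.disjoint hv h.2, Set.disjoint_left.1 hG.disjoint hu h.1]

/-- Anchors, with label 2 standing for b, become positions on the slanted line, and widths become
the lengths of vertical sticks. Only the lengths of horizontal sticks need a choice. -/
lemma isStickGraph_of_isGroundedLGraph [Finite V] (hG : G.IsBipartiteWith A B)
    (hAB : A ∪ B = Set.univ) (h : IsGroundedLGraph (reductionGraph G A B)) :
    IsStickGraph G A B := by
  classical
  obtain ⟨g, L, hL, hrep⟩ := h
  have mem_or : ∀ v, v ∈ A ∨ v ∈ B := fun v => (Set.ext_iff.1 hAB v).2 trivial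
  have hdisj : ∀ v ∈ A, v ∉ B := fun v h => Set.disjoint_left.1 hG.disjoint h
  have hAA := not_adj_of_isBipartiteWith hG
  have hBB := not_adj_of_isBipartiteWith hG.symm
  let s : V → LShape := fun v => if h : v ∈ A then L (Sum.inl ⟨v, h⟩)
    else L (Sum.inr (⟨v, (mem_or v).resolve_left h⟩, 1))
  have sA : ∀ v (h : v ∈ A), s v = L (Sum.inl ⟨v, h⟩) := fun v h => dif_pos h
  have sB : ∀ v (h : v ∈ B), s v = L (Sum.inr (⟨v, h⟩, 1)) :=
    fun v h => dif_neg fun h' => hdisj v h' h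
  have sg : ∀ v, (s v).anchor.2 = g := by
    intro v
    rcases mem_or v with h | h
    exacts [sA v h ▸ hL _, sB v h ▸ hL _]
  have sadj : ∀ u v, u ≠ v → (G.Adj u v ↔ ((s u).carrier ∩ (s v).carrier).Nonempty) := by
    intro u v huv
    rcases mem_or u with hu | hu <;> rcases mem_or v with hv | hv
    · rw [sA u hu, sA v hv, ← hrep _ _ (by simpa using huv)]
      exact iff_of_false (hAA u hu v hv) id
    · rw [sA u hu, sB v hv, ← hrep _ _ (by simp)]
      exact Iff.rfl
    · rw [sB u hu, sA v hv, ← hrep _ _ (by simp)]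
      exact G.adj_comm u v
    · rw [sB u hu, sB v hv, ← hrep _ _ (by simpa using huv)]
      exact iff_of_false (hBB u hu v hv) fun h => huv (congrArg Subtype.val h.1)
  have slt : ∀ u v, (s u).anchor.1 < (s v).anchor.1 →
      (G.Adj u v ↔ (s v).height ≤ (s u).height ∧ (s v).left ≤ (s u).anchor.1) := by
    intro u v h
    rw [sadj u v (by rintro rfl; exact lt_irrefl _ h),
      LShape.inter_nonempty_iff_of_lt ((sg u).trans (sg v).symm) h]
  have seq : ∀ u v, u ≠ v → (s u).anchor.1 = (s v).anchor.1 → G.Adj u v := by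
    intro u v huv h
    rw [sadj u v huv]
    have : (s u).anchor = (s v).anchor := Prod.ext h ((sg u).trans (sg v).symm)
    exact ⟨_, (s u).anchor_mem_carrier, this ▸ (s v).anchor_mem_carrier⟩
  have sle : ∀ a ∈ A, ∀ b ∈ B, G.Adj a b → (s b).anchor.1 ≤ (s a).anchor.1 := by
    intro a ha b hb hab
    rw [sA a ha, sB b hb]
    refine anchor_le_of_forall_inter_gadget (L := fun k => L (Sum.inr (⟨b, hb⟩, k)))
      (fun k => hL _) (hL _) (fun i j hij => ?_) fun k => ?_
    · rw [← hrep _ _ (by simpa using hij)]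
      exact (and_iff_right rfl).symm
    · rw [← hrep _ _ (by simp)]
      exact hab
  have hw : ∀ b, ∃ w, 0 < w ∧ (b ∈ B → ∀ a ∈ A, G.Adj a b ↔
      (s b).anchor.1 ≤ (s a).anchor.1 ∧ (s a).anchor.1 ≤ (s b).anchor.1 + w ∧
        (s a).left ≤ (s b).anchor.1) := by
    intro b
    by_cases hb : b ∈ B
    swap
    · exact ⟨1, one_pos, fun h => absurd h hb⟩
    -- The stick of b must end after `lo` and before `hi`; b itself lies in `lo` to make the length
    -- positive. If some a in `hi` preceded a neighbour u of b, then a would be taller than b, hence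
    -- than u, and u would reach back past a, so a and u would meet.
    let lo : Set V := insert b {a | a ∈ A ∧ G.Adj a b}
    let hi : Set V := {a | a ∈ A ∧ ¬ G.Adj a b ∧ (s b).anchor.1 ≤ (s a).anchor.1 ∧
      (s a).left ≤ (s b).anchor.1}
    have hlt : ∀ a ∈ hi, (s b).anchor.1 < (s a).anchor.1 := by
      rintro a ⟨ha, hab, hle, -⟩
      refine lt_of_le_of_ne hle fun h => hab (seq b a ?_ h).symm
      rintro rfl; exact hdisj _ ha hb
    obtain ⟨m, hm1, hm2⟩ := Order.exists_between_finsets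
      ((Set.toFinite lo).toFinset.image fun v => (s v).anchor.1)
      ((Set.toFinite hi).toFinset.image fun v => (s v).anchor.1) (by
        simp only [Finset.mem_image, Set.Finite.mem_toFinset]
        rintro _ ⟨u, hu, rfl⟩ _ ⟨a, ha, rfl⟩
        rcases hu with rfl | ⟨huA, hub⟩
        · exact hlt a ha
        have hba := hlt a ha
        obtain ⟨haA, hab, -, hal⟩ := ha
        by_contra! hle
        have hne : a ≠ u := by rintro rfl; exact hab hub
        have hlt' : (s a).anchor.1 < (s u).anchor.1 :=
          lt_of_le_of_ne hle fun h => hAA a haA u huA (seq a u hne h)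
        have hnadj := hAA a haA u huA
        have hbu := hub.symm
        rw [slt a u hlt'] at hnadj
        rw [slt b u (hba.trans hlt')] at hbu
        refine hab ((slt b a hba).2 ⟨?_, hal⟩).symm
        by_contra! hh
        exact hnadj ⟨by linarith, by linarith⟩)
    simp only [Finset.mem_image, Set.Finite.mem_toFinset, forall_exists_index, and_imp,
      forall_apply_eq_imp_iff₂] at hm1 hm2
    have hbm := hm1 b (Set.mem_insert _ _)
    refine ⟨m - (s b).anchor.1, by linarith, fun _ a ha => ⟨fun hab => ?_, ?_⟩⟩
    · have h1 := hm1 a (Set.mem_insert_of_mem _ ⟨ha, hab⟩)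
      have h2 := sle a ha b hb hab
      refine ⟨h2, by linarith, ?_⟩
      rcases h2.lt_or_eq with h | h
      · exact ((slt b a h).1 hab.symm).2
      · exact h ▸ (s a).left_lt.le
    · rintro ⟨h1, h2, h3⟩
      by_contra hab
      have := hm2 a ⟨ha, hab, h1, h3⟩
      linarith
  choose w hw0 hw using hw
  let p : V → ℝ × ℝ := fun v => ((s v).anchor.1, 0 - (s v).anchor.1)
  let len : V → ℝ := fun v => if v ∈ A then (s v).width else w v
  let S : V → Set (ℝ × ℝ) :=
    fun v => if v ∈ A then vSegment (p v) (len v) else hSegment (p v) (len v)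
  have SA : ∀ a ∈ A, S a = vSegment (p a) (len a) := fun a ha => if_pos ha
  have SB : ∀ b ∈ B, S b = hSegment (p b) (len b) := fun b hb => if_neg fun h => hdisj b h hb
  have hSadj : ∀ a ∈ A, ∀ b ∈ B, (G.Adj a b ↔ (S a ∩ S b).Nonempty) := by
    intro a ha b hb
    rw [SA a ha, SB b hb, vSegment_inter_hSegment_nonempty, hw b hb a ha]
    simp only [len, if_pos ha, if_neg fun h => hdisj b h hb]
    rfl
  refine ⟨0, p, len, S, fun v => rfl, fun v => ?_, SA, SB, fun u v huv => ?_⟩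
  · by_cases hv : v ∈ A
    · simpa only [len, if_pos hv] using (s v).width_pos
    · simpa only [len, if_neg hv] using hw0 v
  · rcases mem_or u with hu | hu <;> rcases mem_or v with hv | hv
    · refine iff_of_false (hAA u hu v hv) fun h => hAA u hu v hv (seq u v huv ?_)
      rw [SA u hu, SA v hv] at h
      have : (p u).1 = (p v).1 := fst_eq_of_vSegment_inter_nonempty h
      exact this
    · exact hSadj u hu v hv
    · rw [G.adj_comm, Set.inter_comm]
      exact hSadj v hv u hu
    · refine iff_of_false (hBB u hu v hv) fun h => hBB u hu v hv (seq u v huv ?_)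
      rw [SB u hu, SB v hv] at h
      have := snd_eq_of_hSegment_inter_nonempty h
      simp only [p] at this
      linarith

/-! ### From sticks to grounded L-shapes -/

/-- Abscissae of the anchors in a representation of the gadget by grounded L-shapes. -/
def gadgetAnchor : Fin 10 → ℤ := ![14, 10, 6, 4, 2, 8, 12, 18, 16, 0]

/-- Heights in a representation of the gadget by grounded L-shapes. -/
def gadgetHeight : Fin 10 → ℤ := ![1, 2, 3, 1, 2, 0, 4, 2, 3, 4]

/-- Abscissae of the left end-points in a representation of the gadget by grounded L-shapes. -/
def gadgetLeft : Fin 10 → ℤ := ![4, 2, 5, 0, 1, 0, 0, 10, 0, -1]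

lemma gadget_adj_iff : ∀ i j, gadgetAnchor i < gadgetAnchor j →
    (gadget.Adj i j ↔ gadgetHeight j ≤ gadgetHeight i ∧ gadgetLeft j ≤ gadgetAnchor i) := by
  decide

lemma gadgetAnchor_injective : ∀ i j, gadgetAnchor i = gadgetAnchor j → i = j := by decide

lemma gadget_bounds : ∀ i, gadgetAnchor i ≤ 18 ∧ 0 ≤ gadgetHeight i ∧ gadgetHeight i ≤ 4 ∧
    -1 ≤ gadgetLeft i ∧ gadgetLeft i < gadgetAnchor i := by decide

/-- The elements of a finite set of reals are separated by a common distance. -/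
lemma exists_pos_forall_add_lt {D : Set ℝ} (hD : D.Finite) :
    ∃ ε > 0, ∀ s ∈ D, ∀ t ∈ D, s < t → s + ε < t := by
  obtain ⟨m, hm1, hm2⟩ := Order.exists_between_finsets {0}
    (((hD.prod hD).toFinset.filter fun q => q.1 < q.2).image fun q => q.2 - q.1) (by
      simp only [Finset.mem_singleton, Finset.mem_image, Finset.mem_filter]
      rintro _ rfl _ ⟨q, ⟨-, hq⟩, rfl⟩
      linarith)
  refine ⟨m, hm1 0 (by simp), fun s hs t ht hst => ?_⟩
  have := hm2 (t - s) (Finset.mem_image.2 ⟨(s, t), by simp [hs, ht, hst], rfl⟩)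
  linarith

/-- Heights encode x(a) and x(b) + l(b), and left ends encode x(a) - l(a). Shapes of A are disjoint
because their heights increase with their anchors. Each b becomes a tiny gadget just left of x(b).
-/
lemma isGroundedLGraph_of_isStickGraph [Finite V] (hG : G.IsBipartiteWith A B)
    (h : IsStickGraph G A B) : IsGroundedLGraph (reductionGraph G A B) := by
  obtain ⟨c, p, len, S, hp, hlen, SA, SB, hrep⟩ := h
  have hdisj : ∀ v ∈ A, v ∉ B := fun v h => Set.disjoint_left.1 hG.disjoint h
  have hAA := not_adj_of_isBipartiteWith hG
  have hBB := not_adj_of_isBipartiteWith hG.symm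
  let x : V → ℝ := fun v => (p v).1
  have hpx : ∀ v, p v = (x v, c - x v) := fun v => Prod.ext rfl (hp v)
  have hadj : ∀ a ∈ A, ∀ b ∈ B, (G.Adj a b ↔ x b ≤ x a ∧ x a ≤ x b + len b ∧
      x a - len a ≤ x b) := by
    intro a ha b hb
    have hne : a ≠ b := by rintro rfl; exact hdisj a ha hb
    rw [hrep a b hne, SA a ha, SB b hb, hpx a, hpx b, vSegment_inter_hSegment_nonempty]
  have hmem : ∀ v, p v ∈ S v ∨ v ∉ A ∪ B := by
    intro v
    have hl := (hlen v).le
    by_cases hA : v ∈ A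
    · exact Or.inl (SA v hA ▸ ⟨rfl, le_rfl, by linarith⟩)
    by_cases hB : v ∈ B
    · exact Or.inl (SB v hB ▸ ⟨⟨le_rfl, by linarith⟩, rfl⟩)
    exact Or.inr fun h => h.elim hA hB
  have hinj : ∀ u ∈ A ∪ B, ∀ v ∈ A ∪ B, u ≠ v → ¬ G.Adj u v → x u ≠ x v := by
    intro u hu v hv huv hnadj hx
    refine hnadj ((hrep u v huv).2 ⟨p u, (hmem u).resolve_right (not_not.2 hu), ?_⟩)
    have : p u = p v := by rw [hpx u, hpx v, hx]
    exact this ▸ (hmem v).resolve_right (not_not.2 hv)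
  let D : Set ℝ := Set.range x ∪ Set.range (fun v => x v + len v) ∪
    Set.range (fun v => x v - len v)
  have hD : D.Finite :=
    ((Set.finite_range _).union (Set.finite_range _)).union (Set.finite_range _)
  have D1 : ∀ v, x v ∈ D := fun v => Or.inl (Or.inl ⟨v, rfl⟩)
  have D2 : ∀ v, x v + len v ∈ D := fun v => Or.inl (Or.inr ⟨v, rfl⟩)
  have D3 : ∀ v, x v - len v ∈ D := fun v => Or.inr ⟨v, rfl⟩
  obtain ⟨δ, hδ, hsep⟩ := exists_pos_forall_add_lt hD
  -- In units of ε, gadget anchors lie in [-20, -2] relative to x(b), left ends are at least -21,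
  -- and heights vary by at most 4. Lengthening the shapes of A by 21 lets them pass the whole
  -- gadget, and the gap of 30 absorbs all these errors.
  obtain ⟨ε, hε, rfl⟩ : ∃ ε > 0, δ = 30 * ε := ⟨δ / 30, by positivity, by ring⟩
  -- Subtracting the lower bound K and adding 1 makes all heights positive without affecting
  -- comparisons.
  obtain ⟨K, hK⟩ := hD.bddBelow
  have hbd : ∀ k, (gadgetAnchor k : ℝ) * ε ≤ 18 * ε ∧ 0 ≤ (gadgetHeight k : ℝ) * ε ∧
      (gadgetHeight k : ℝ) * ε ≤ 4 * ε ∧ -1 * ε ≤ (gadgetLeft k : ℝ) * ε ∧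
      (gadgetLeft k : ℝ) * ε < (gadgetAnchor k : ℝ) * ε := by
    intro k
    obtain ⟨h1, h2, h3, h4, h5⟩ := gadget_bounds k
    refine ⟨mul_le_mul_of_nonneg_right (by exact_mod_cast h1) hε.le,
      mul_nonneg (by exact_mod_cast h2) hε.le,
      mul_le_mul_of_nonneg_right (by exact_mod_cast h3) hε.le,
      mul_le_mul_of_nonneg_right (by exact_mod_cast h4) hε.le,
      mul_lt_mul_of_pos_right (by exact_mod_cast h5) hε⟩
  let LA : V → LShape := fun a =>
    { anchor := (x a, 0)
      height := x a - K + 1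
      width := len a + 21 * ε
      height_pos := by linarith [hK (D1 a)]
      width_pos := by linarith [hlen a] }
  let LB : V → Fin 10 → LShape := fun b k =>
    { anchor := (x b - 20 * ε + gadgetAnchor k * ε, 0)
      height := x b + len b - K + 1 + gadgetHeight k * ε
      width := gadgetAnchor k * ε - gadgetLeft k * ε
      height_pos := by linarith [hK (D2 b), (hbd k).2.1]
      width_pos := by linarith [(hbd k).2.2.2.2] }
  have gA : ∀ a, (LA a).anchor.2 = 0 := fun _ => rfl
  have gB : ∀ b k, (LB b k).anchor.2 = 0 := fun _ _ => rfl
  have hleftA : ∀ a, (LA a).left = x a - len a - 21 * ε := fun a => by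
    simp only [LShape.left, LA]; ring
  have hleftB : ∀ b k, (LB b k).left = x b - 20 * ε + gadgetLeft k * ε := fun b k => by
    simp only [LShape.left, LB]; ring
  have iAA : ∀ u v, x u < x v → ¬ ((LA u).carrier ∩ (LA v).carrier).Nonempty := by
    intro u v huv
    rw [LShape.inter_nonempty_iff_of_lt ((gA u).trans (gA v).symm) huv]
    simp only [LA]
    exact fun h => by linarith [h.1]
  have iBB : ∀ u v i j, x u < x v → ¬ ((LB u i).carrier ∩ (LB v j).carrier).Nonempty := by
    intro u v i j huv
    have := hsep _ (D1 u) _ (D1 v) huv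
    have hi := hbd i
    have hj := hbd j
    rw [LShape.inter_nonempty_iff_of_lt ((gB u i).trans (gB v j).symm) (by simp only [LB]; linarith), hleftB]
    simp only [LB]
    exact fun h => by linarith [h.2]
  have iB : ∀ b i j, gadgetAnchor i < gadgetAnchor j →
      (gadget.Adj i j ↔ ((LB b i).carrier ∩ (LB b j).carrier).Nonempty) := by
    intro b i j hij
    have hlt : (gadgetAnchor i : ℝ) * ε < gadgetAnchor j * ε :=
      mul_lt_mul_of_pos_right (by exact_mod_cast hij) hε
    rw [LShape.inter_nonempty_iff_of_lt ((gB b i).trans (gB b j).symm) (by simp only [LB]; linarith), hleftB,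
      gadget_adj_iff i j hij]
    simp only [LB, add_le_add_iff_left, mul_le_mul_iff_left₀ hε, Int.cast_le]
  have iAB : ∀ a ∈ A, ∀ b ∈ B, ∀ k,
      (G.Adj a b ↔ ((LA a).carrier ∩ (LB b k).carrier).Nonempty) := by
    intro a ha b hb k
    have hk := hbd k
    rw [hadj a ha b hb]
    rcases lt_or_ge (x a) (x b) with hab | hab
    · have := hsep _ (D1 a) _ (D1 b) hab
      rw [LShape.inter_nonempty_iff_of_lt ((gA a).trans (gB b k).symm) (by simp only [LA, LB]; linarith), hleftB]
      simp only [LA]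
      exact iff_of_false (fun h => by linarith [h.1]) (fun h => by linarith [h.2])
    · rw [Set.inter_comm,
        LShape.inter_nonempty_iff_of_lt ((gB b k).trans (gA a).symm) (by simp only [LA, LB]; linarith), hleftA]
      simp only [LA, LB]
      constructor
      · rintro ⟨-, h1, h2⟩
        exact ⟨by linarith, by linarith⟩
      · rintro ⟨h1, h2⟩
        refine ⟨hab, ?_, ?_⟩
        · by_contra! h
          linarith [hsep _ (D2 b) _ (D1 a) h]
        · by_contra! h
          linarith [hsep _ (D1 b) _ (D3 a) h]
  refine ⟨0, Sum.elim (fun a => LA a) (fun q => LB q.1 q.2), ?_, ?_⟩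
  · rintro (a | q) <;> rfl
  · rintro (⟨a, ha⟩ | ⟨⟨b, hb⟩, i⟩) (⟨a', ha'⟩ | ⟨⟨b', hb'⟩, j⟩) hne
    · have hne' : a ≠ a' := by simpa using hne
      refine iff_of_false id ?_
      rcases (hinj a (Or.inl ha) a' (Or.inl ha') hne' (hAA a ha a' ha')).lt_or_gt with h | h
      · exact iAA _ _ h
      · exact Set.inter_comm _ _ ▸ iAA _ _ h
    · exact iAB a ha b' hb' j
    · exact Set.inter_comm _ _ ▸ iAB a' ha' b hb i
    · by_cases hbb : b = b'
      · subst hbb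
        have hij : i ≠ j := by simpa using hne
        refine (and_iff_right rfl).trans ?_
        rcases lt_trichotomy (gadgetAnchor i) (gadgetAnchor j) with h | h | h
        · exact iB b i j h
        · exact absurd (gadgetAnchor_injective i j h) hij
        · rw [gadget.adj_comm]
          exact Set.inter_comm _ _ ▸ iB b j i h
      · refine iff_of_false (fun h => hbb (congrArg Subtype.val h.1)) ?_
        rcases (hinj b (Or.inr hb) b' (Or.inr hb') hbb (hBB b hb b' hb')).lt_or_gt with h | h
        · exact iBB _ _ _ _ h
        · exact Set.inter_comm _ _ ▸ iBB _ _ _ _ h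

end

theorem mainTheorem4 {V : Type*} [Finite V] (G : SimpleGraph V) (A B : Set V)
    (hG : G.IsBipartiteWith A B) (hAB : A ∪ B = Set.univ) :
    IsStickGraph G A B ↔ IsGroundedLGraph (reductionGraph G A B) :=
  ⟨isGroundedLGraph_of_isStickGraph hG, isStickGraph_of_isGroundedLGraph hG hAB⟩
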